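/- Let $\mathbb X\subset\mathbb R^m$ be a Borel set (the state space), let $\mathbb U\subset\mathbb R^k$ be compact (the action space), let $\beta\in(0,1)$, and let $c:\mathbb X\times\mathbb U\to\mathbb R$ be continuous and bounded. Let $\mathcal T$ and $\mathcal T_n$ ($n\in\mathbb N$) be stochastic kernels from $\mathbb X\times\mathbb U$ to $\mathbb X$ such that $\mathcal T_n(\cdot\mid x_n,u_n)\to\mathcal T(\cdot\mid x,u)$ weakly for every $(x,u)\in\mathbb X\times\mathbb U$ and every sequence $(x_n,u_n)\to(x,u)$ in $\mathbb X\times\mathbb U$. An admissible policy $\gamma$ is a sequence of measurable maps $\gamma_t$ giving the action $U_t=\gamma_t(X_0,\dots,X_t,U_0,\dots,U_{t-1})$; it is stationary if $U_t=\gamma(X_t)$ for one measurable $\gamma:\mathbb X\to\mathbb U$. For a kernel $\mathcal S$, an initial state $x_0$ and a policy $\gamma$, let $$J_\beta(x_0,\mathcal S,\gamma)=E^{\mathcal S,\gamma}_{x_0}\Big[\sum_{t=0}^\infty\beta^t c(X_t,U_t)\Big],$$ where $X_0=x_0$ and $X_{t+1}$ has conditional law $\mathcal S(\cdot\mid X_t,U_t)$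 given the past $(X_s,U_s)_{s\le t}$. Then for every initial state $x_0\in\mathbb X$, as $n\to\infty$: 1. $\inf_\gamma J_\beta(x_0,\mathcal T_n,\gamma)\to\inf_\gamma J_\beta(x_0,\mathcal T,\gamma)$, the infima being over all admissible policies; 2. the same holds with the infima over stationary policies; 3. if $\gamma_n^*$ and $\gamma^*$ are stationary policies that attain the infima over stationary policies for $\mathcal T_n$ and $\mathcal T$ respectively from $x_0$, then $J_\beta(x_0,\mathcal T_n,\gamma_n^*)\to J_\beta(x_0,\mathcal T,\gamma^*)$. -/

import Mathlib

open MeasureTheory ProbabilityTheory Filter Topology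

noncomputable section

namespace MDP

/-- Admissible (deterministic, history-dependent) policies of a fully observed model. The action at
time `0` is `init x₀`; the action at time `t + 1` is a measurable function of the past states and
actions `(x₀, u₀), …, (x_t, u_t)` and of the current state `x_{t+1}`. -/
structure Policy (X U : Type*) [MeasurableSpace X] [MeasurableSpace U] where
  init : X → U
  step : (t : ℕ) → ((Finset.Iic t → X × U) × X) → U
  measurable_init : Measurable init
  measurable_step : ∀ t, Measurable (step t)

/-- Stationary deterministic policies: `U_t = γ(X_t)` for a measurable `γ`. -/
abbrev StationaryPolicy (X U : Type*) [MeasurableSpace X] [MeasurableSpace U] :=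
  {γ : X → U // Measurable γ}

variable {X U : Type*} [MeasurableSpace X] [MeasurableSpace U]

/-- A stationary policy as an admissible policy. -/
def StationaryPolicy.toPolicy (γ : StationaryPolicy X U) : Policy X U where
  init := γ.1
  step _ p := γ.1 p.2
  measurable_init := γ.2
  measurable_step _ := γ.2.comp measurable_snd

/-- The probability measure `T(· | p)` as a point of the space of probability measures with the
topology of weak convergence. -/
def law (T : Kernel (X × U) X) [IsMarkovKernel T] (p : X × U) : ProbabilityMeasure X :=
  ⟨T p, inferInstance⟩

/-- The conditional law of `(X_{t+1}, U_{t+1})` given `(X_s, U_s)`, `s ≤ t`: the next state has law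
`T(· | x_t, u_t)`, and the next action is the one that the policy prescribes. -/
def stepKernel (T : Kernel (X × U) X) (γ : Policy X U) (t : ℕ) :
    Kernel (Finset.Iic t → X × U) (X × U) :=
  (Kernel.id ×ₖ T.comap (fun h : Finset.Iic t → X × U => h ⟨t, Finset.mem_Iic.2 le_rfl⟩)
    (measurable_pi_apply _)).map (fun p => (p.2, γ.step t p))

instance stepKernel_isMarkovKernel (T : Kernel (X × U) X) [IsMarkovKernel T] (γ : Policy X U)
    (t : ℕ) : IsMarkovKernel (stepKernel T γ t) :=
  Kernel.IsMarkovKernel.map _ (measurable_snd.prodMk (γ.measurable_step t))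

/-- The law of the process `((X_t, U_t))_{t ≥ 0}` (the strategic measure) under the transition
kernel `T` and the policy `γ`, for the initial state `x₀`. -/
def pathMeasure (T : Kernel (X × U) X) [IsMarkovKernel T] (γ : Policy X U) (x₀ : X) :
    Measure (ℕ → X × U) :=
  Kernel.trajMeasure (X := fun _ : ℕ => X × U) (Measure.dirac (x₀, γ.init x₀)) (stepKernel T γ)

/-- The infinite-horizon discounted cost `E[∑ₜ βᵗ c(X_t, U_t)]`. -/
def discountedCost (β : ℝ) (c : X × U → ℝ) (T : Kernel (X × U) X) [IsMarkovKernel T]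
    (γ : Policy X U) (x₀ : X) : ℝ :=
  ∫ ω, ∑' t : ℕ, β ^ t * c (ω t) ∂(pathMeasure T γ x₀)

/-- The optimal discounted cost over all admissible policies. -/
def optimalCost (β : ℝ) (c : X × U → ℝ) (T : Kernel (X × U) X) [IsMarkovKernel T] (x₀ : X) : ℝ :=
  ⨅ γ : Policy X U, discountedCost β c T γ x₀

/-- The optimal discounted cost over stationary deterministic policies. -/
def stationaryOptimalCost (β : ℝ) (c : X × U → ℝ) (T : Kernel (X × U) X) [IsMarkovKernel T]
    (x₀ : X) : ℝ :=
  ⨅ γ : StationaryPolicy X U, discountedCost β c T γ.toPolicy x₀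

/-- The stationary policy `γ` is optimal for the initial state `x₀` among stationary policies. -/
def IsOptimalStationary (β : ℝ) (c : X × U → ℝ) (T : Kernel (X × U) X) [IsMarkovKernel T]
    (x₀ : X) (γ : StationaryPolicy X U) : Prop :=
  ∀ γ' : StationaryPolicy X U,
    discountedCost β c T γ.toPolicy x₀ ≤ discountedCost β c T γ'.toPolicy x₀

end MDP

end

/-! Let v solve the optimality equation of the limit kernel `T`; it exists by contraction, `T` being
weakly continuous as a continuous limit. For any kernel and policy, the cost minus v(x₀) is the
expected discounted sum of Bellman residuals of v (`discountedCost_sub_eq_tsum`). Under `Tn` the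
residual splits into the residual for `T`, which is nonnegative, and β times e_n = ∫ v dTn - ∫ v dT,
which converges continuously to 0.

The crux is that E|e_n(X_t, U_t)| → 0 uniformly over all policies (`tendsto_integral_eval_zero`).
Every cost under `Tn` is then at least v(x₀) - o(1), while a stationary measurable near-minimizer
for `T` costs at most v(x₀) + ε eventually. Both infima therefore tend to v(x₀), which depends on
`T` only; the constant sequence `T` identifies it with both optimal costs of `T`. -/

namespace MDP

open scoped BoundedContinuousFunction

/-! ### Marginals and one-step conditional laws of the strategic measure -/

section Path

variable {X U : Type*} [MeasurableSpace X] [MeasurableSpace U]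

theorem stepKernel_apply (T : Kernel (X × U) X) [IsMarkovKernel T] (γ : Policy X U) (t : ℕ)
    (h : Finset.Iic t → X × U) :
    stepKernel T γ t h =
      (T (h ⟨t, Finset.mem_Iic.2 le_rfl⟩)).map (fun y => (y, γ.step t (h, y))) := by
  have hm : Measurable (fun p : (Finset.Iic t → X × U) × X => (p.2, γ.step t p)) :=
    measurable_snd.prodMk (γ.measurable_step t)
  rw [stepKernel, Kernel.map_apply _ hm, Kernel.prod_apply, Kernel.id_apply, Kernel.comap_apply,
    Measure.dirac_prod, Measure.map_map hm measurable_prodMk_left]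
  rfl

instance (T : Kernel (X × U) X) [IsMarkovKernel T] (γ : Policy X U) (x₀ : X) :
    IsProbabilityMeasure (pathMeasure T γ x₀) := by
  unfold pathMeasure
  infer_instance

theorem map_eval_zero_pathMeasure (T : Kernel (X × U) X) [IsMarkovKernel T] (γ : Policy X U)
    (x₀ : X) :
    (pathMeasure T γ x₀).map (fun ω => ω 0) = Measure.dirac (x₀, γ.init x₀) := by
  have h0 : (fun ω : ℕ → X × U => ω 0) =
      (fun h : Finset.Iic 0 → X × U => h ⟨0, by simp⟩) ∘ Preorder.frestrictLe 0 := rfl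
  rw [h0, ← Measure.map_map (by fun_prop) (by fun_prop), pathMeasure, Kernel.trajMeasure,
    Measure.map_comp _ _ (by fun_prop), Kernel.traj_map_frestrictLe, Kernel.partialTraj_self,
    Measure.id_comp, Measure.map_map (by fun_prop) (by fun_prop)]
  exact Measure.map_id

theorem integral_eval_zero (T : Kernel (X × U) X) [IsMarkovKernel T] (γ : Policy X U)
    (x₀ : X) {f : X × U → ℝ} (hf : Measurable f) :
    ∫ ω, f (ω 0) ∂(pathMeasure T γ x₀) = f (x₀, γ.init x₀) := by
  have := integral_map (μ := pathMeasure T γ x₀) (φ := fun ω => ω 0) (f := f)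
    (measurable_pi_apply 0).aemeasurable hf.aestronglyMeasurable
  rw [← this, map_eval_zero_pathMeasure, integral_dirac' _ _ hf.stronglyMeasurable]

theorem map_frestrictLe_eval_succ_pathMeasure (T : Kernel (X × U) X) [IsMarkovKernel T]
    (γ : Policy X U) (x₀ : X) (t : ℕ) :
    (pathMeasure T γ x₀).map (fun ω => (Preorder.frestrictLe t ω, ω (t + 1))) =
      (pathMeasure T γ x₀).map (Preorder.frestrictLe t) ⊗ₘ stepKernel T γ t :=
  (Kernel.map_frestrictLe_trajMeasure_compProd_eq_map_trajMeasure
    (X := fun _ : ℕ => X × U) (κ := stepKernel T γ)).symm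

/-- The next state has conditional law `T(· | X_t, U_t)`. -/
theorem integral_eval_succ_fst (T : Kernel (X × U) X) [IsMarkovKernel T] (γ : Policy X U)
    (x₀ : X) (t : ℕ) {f : X → ℝ} (hf : Measurable f) {C : ℝ} (hC : ∀ x, |f x| ≤ C) :
    ∫ ω, f (ω (t + 1)).1 ∂(pathMeasure T γ x₀) =
      ∫ ω, ∫ y, f y ∂(T (ω t)) ∂(pathMeasure T γ x₀) := by
  have hf' : Measurable (fun q : (Finset.Iic t → X × U) × (X × U) => f q.2.1) := by fun_prop
  have h1 := integral_map (μ := pathMeasure T γ x₀)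
    (φ := fun ω => (Preorder.frestrictLe (π := fun _ => X × U) t ω, ω (t + 1)))
    (f := fun q : (Finset.Iic t → X × U) × (X × U) => f q.2.1)
    (by fun_prop) hf'.aestronglyMeasurable
  have : IsProbabilityMeasure
      ((pathMeasure T γ x₀).map (Preorder.frestrictLe (π := fun _ => X × U) t)) :=
    Measure.isProbabilityMeasure_map (by fun_prop)
  rw [← h1, map_frestrictLe_eval_succ_pathMeasure, Measure.integral_compProd]
  · rw [integral_map (by fun_prop)]
    · refine integral_congr_ae (ae_of_all _ fun ω => ?_)
      dsimp only
      rw [stepKernel_apply, integral_map]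
      · rfl
      · exact (measurable_id.prodMk ((γ.measurable_step t).comp
          measurable_prodMk_left)).aemeasurable
      · exact (hf.comp measurable_fst).aestronglyMeasurable
    · exact (StronglyMeasurable.integral_kernel_prod_right'
        hf'.stronglyMeasurable).aestronglyMeasurable
  · exact Integrable.of_bound hf'.aestronglyMeasurable C (ae_of_all _ fun q => hC _)

/-- Under a stationary policy the action is prescribed by the current state. -/
theorem ae_eval_mem_of_stationary (T : Kernel (X × U) X) [IsMarkovKernel T]
    (γ : StationaryPolicy X U) (x₀ : X) {S : Set (X × U)} (hS : MeasurableSet S)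
    (hγ : ∀ x, (x, γ.1 x) ∈ S) (t : ℕ) :
    ∀ᵐ ω ∂(pathMeasure T γ.toPolicy x₀), ω t ∈ S := by
  cases t with
  | zero =>
    have h : ∀ᵐ p ∂((pathMeasure T γ.toPolicy x₀).map (fun ω => ω 0)), p ∈ S := by
      rw [map_eval_zero_pathMeasure]
      exact (ae_dirac_iff (p := (· ∈ S)) hS).2 (hγ x₀)
    exact ae_of_ae_map (measurable_pi_apply 0).aemeasurable h
  | succ t =>
    have h : ∀ᵐ q ∂((pathMeasure T γ.toPolicy x₀).map
        (fun ω => (Preorder.frestrictLe (π := fun _ => X × U) t ω, ω (t + 1)))), q.2 ∈ S := by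
      rw [map_frestrictLe_eval_succ_pathMeasure]
      refine Measure.ae_compProd_of_ae_ae (measurable_snd hS) (ae_of_all _ fun h => ?_)
      rw [stepKernel_apply]
      refine (ae_map_iff (p := (· ∈ S)) ?_ hS).2 (ae_of_all _ fun y => hγ y)
      exact (measurable_id.prodMk ((γ.toPolicy.measurable_step t).comp
        measurable_prodMk_left)).aemeasurable
    exact ae_of_ae_map
      (f := fun ω => (Preorder.frestrictLe (π := fun _ => X × U) t ω, ω (t + 1)))
      (by fun_prop) h

end Path

/-! ### Continuous convergence, uniformly over policies -/

section ContinuousConvergence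

/-- Continuous convergence along sequences implies continuous convergence along filters. -/
theorem tendsto_atTop_prod_nhds_of_seq {A B : Type*} [TopologicalSpace A]
    [FirstCountableTopology A] [TopologicalSpace B] {F : ℕ → A → B} {a : A} {b : B}
    (h : ∀ s : ℕ → A, Tendsto s atTop (𝓝 a) → Tendsto (fun n => F n (s n)) atTop (𝓝 b)) :
    Tendsto (fun q : ℕ × A => F q.1 q.2) (atTop ×ˢ 𝓝 a) (𝓝 b) := by
  refine tendsto_of_subseq_tendsto fun ns hns => ?_
  have h1 : Tendsto (fun k => (ns k).1) atTop atTop := tendsto_fst.comp hns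
  have h2 : Tendsto (fun k => (ns k).2) atTop (𝓝 a) := tendsto_snd.comp hns
  obtain ⟨φ, hφ, hm⟩ := strictMono_subseq_of_tendsto_atTop h1
  refine ⟨φ, ?_⟩
  set ν : ℕ → ℕ := fun k => (ns (φ k)).1
  have hν : StrictMono ν := hm
  -- The subsequence is placed at its own indices `ν k` and filled in with the constant `a`, so that
  -- it becomes a full sequence to which `h` applies.
  set s : ℕ → A := Function.extend ν (fun k => (ns (φ k)).2) (fun _ => a)
  have hs : ∀ k, s (ν k) = (ns (φ k)).2 := fun k => hν.injective.extend_apply _ _ k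
  have hsa : Tendsto s atTop (𝓝 a) := by
    refine tendsto_def.2 fun W hW => ?_
    have := (h2.comp hφ.tendsto_atTop).eventually_mem hW
    obtain ⟨K, hK⟩ := eventually_atTop.1 this
    refine mem_atTop_sets.2 ⟨ν K, fun m hm => ?_⟩
    by_cases hr : ∃ k, ν k = m
    · obtain ⟨k, rfl⟩ := hr
      simpa [hs] using hK k (hν.le_iff_le.1 hm)
    · simpa [s, Function.extend_apply' _ _ _ hr] using mem_of_mem_nhds hW
  have := (h s hsa).comp hν.tendsto_atTop
  simpa [Function.comp_def, hs] using this

/-- The limit of a continuously convergent sequence of functions is continuous. -/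
theorem continuous_of_tendsto_atTop_prod_nhds {A B : Type*} [TopologicalSpace A]
    [TopologicalSpace B] [RegularSpace B] {F : ℕ → A → B} {f : A → B}
    (h : ∀ a, Tendsto (fun q : ℕ × A => F q.1 q.2) (atTop ×ˢ 𝓝 a) (𝓝 (f a))) :
    Continuous f := by
  refine continuous_iff_continuousAt.2 fun a => ?_
  refine (closed_nhds_basis (f a)).tendsto_right_iff.2 fun W ⟨hW, hWc⟩ => ?_
  have h1 : ∀ᶠ q : A × ℕ in 𝓝 a ×ˢ atTop, F q.2 q.1 ∈ W :=
    eventually_swap_iff.1 ((h a).eventually_mem hW)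
  -- For y near a, `F n y` lies in `W` for all large n; the limit `f y` stays in `W` because `W` is
  -- closed.
  filter_upwards [h1.curry] with y hy
  have h2 : Tendsto (fun n => F n y) atTop (𝓝 (f y)) :=
    (h y).comp (tendsto_id.prodMk (tendsto_const_nhds (x := y)))
  exact hWc.mem_of_tendsto h2 hy

/-- Uniformity over a compact factor in continuous convergence to zero. -/
theorem eventually_forall_le_of_tendsto_zero {X U : Type*} [TopologicalSpace X]
    [TopologicalSpace U] [CompactSpace U] {f : ℕ → X × U → ℝ}
    (hf : ∀ p, Tendsto (fun q : ℕ × (X × U) => f q.1 q.2) (atTop ×ˢ 𝓝 p) (𝓝 0))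
    {ε : ℝ} (hε : 0 < ε) (x : X) :
    ∀ᶠ q : ℕ × X in atTop ×ˢ 𝓝 x, ∀ u, f q.1 (q.2, u) ≤ ε := by
  have h1 : {r : (ℕ × X) × U | f r.1.1 (r.1.2, r.2) ≤ ε} ∈
      (atTop ×ˢ 𝓝 x) ×ˢ 𝓝ˢ (Set.univ : Set U) := by
    refine isCompact_univ.mem_prod_nhdsSet_of_forall fun u _ => ?_
    have h2 : Tendsto (fun r : (ℕ × X) × U => (r.1.1, (r.1.2, r.2)))
        ((atTop ×ˢ 𝓝 x) ×ˢ 𝓝 u) (atTop ×ˢ 𝓝 (x, u)) := by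
      rw [nhds_prod_eq]
      exact tendsto_prodAssoc
    exact ((hf (x, u)).comp h2).eventually_le_const hε
  have h3 : ∀ᶠ r : (ℕ × X) × U in (atTop ×ˢ 𝓝 x) ×ˢ 𝓝ˢ (Set.univ : Set U),
      f r.1.1 (r.1.2, r.2) ≤ ε := h1
  rw [nhdsSet_univ] at h3
  exact h3.curry.mono fun q hq u => eventually_top.1 hq u

/-- Asking for the bound at all later indices makes the sets increase, and taking interiors makes
them open. They still cover the space because the bound, uniform in u, holds on a whole
neighbourhood of each point from some index on. -/
theorem exists_isOpen_exhaustion_of_tendsto_zero {X U : Type*} [TopologicalSpace X]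
    [TopologicalSpace U] [CompactSpace U] {f : ℕ → X × U → ℝ}
    (hf : ∀ p, Tendsto (fun q : ℕ × (X × U) => f q.1 q.2) (atTop ×ˢ 𝓝 p) (𝓝 0))
    {ε : ℝ} (hε : 0 < ε) :
    ∃ A : ℕ → Set X, (∀ n, IsOpen (A n)) ∧ Monotone A ∧ ⋃ n, A n = Set.univ ∧
      ∀ n, ∀ x ∈ A n, ∀ u, f n (x, u) ≤ ε := by
  refine ⟨fun n => interior {x | ∀ m ≥ n, ∀ u, f m (x, u) ≤ ε}, fun n => isOpen_interior,
    fun a b hab => interior_mono fun x hx m hm => hx m (hab.trans hm), ?_,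
    fun n x hx u => interior_subset hx n le_rfl u⟩
  refine Set.eq_univ_of_forall fun x => ?_
  have h := eventually_forall_le_of_tendsto_zero hf hε x
  obtain ⟨s, hs, W, hW, hsW⟩ := mem_prod_iff.1 h
  obtain ⟨N, hN⟩ := mem_atTop_sets.1 hs
  refine Set.mem_iUnion.2 ⟨N, mem_interior_iff_mem_nhds.2 ?_⟩
  filter_upwards [hW] with y hy m hm
  exact hsW (Set.mk_mem_prod (hN m hm) hy)

variable {X U : Type*} [PseudoMetricSpace X] [MeasurableSpace X] [BorelSpace X]
  [TopologicalSpace U] [MeasurableSpace U]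

/-- The complements decrease, so for n ≥ N the n-th one lies in the fixed closed complement of `A
N`, to which the portmanteau bound applies; its `T p`-mass is small for large N by continuity from
above. -/
theorem tendsto_measureReal_compl_of_exhaustion {Tn : ℕ → Kernel (X × U) X}
    [∀ n, IsMarkovKernel (Tn n)] {T : Kernel (X × U) X} [IsMarkovKernel T] {p : X × U}
    (hT : Tendsto (fun q : ℕ × (X × U) => law (Tn q.1) q.2) (atTop ×ˢ 𝓝 p) (𝓝 (law T p)))
    {A : ℕ → Set X} (hA : ∀ n, IsOpen (A n)) (hm : Monotone A) (hU : ⋃ n, A n = Set.univ) :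
    Tendsto (fun q : ℕ × (X × U) => (Tn q.1 q.2).real (A q.1)ᶜ) (atTop ×ˢ 𝓝 p) (𝓝 0) := by
  have key : Tendsto (fun q : ℕ × (X × U) => Tn q.1 q.2 (A q.1)ᶜ) (atTop ×ˢ 𝓝 p) (𝓝 0) := by
    refine ENNReal.tendsto_nhds_zero.2 fun ε hε => ?_
    have h1 : Tendsto (fun n => T p (A n)ᶜ) atTop (𝓝 0) := by
      have := tendsto_measure_iInter_atTop (μ := T p) (s := fun n => (A n)ᶜ)
        (fun n => (hA n).measurableSet.compl.nullMeasurableSet)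
        (fun a b hab => Set.compl_subset_compl.2 (hm hab)) ⟨0, measure_ne_top _ _⟩
      rwa [← Set.compl_iUnion, hU, Set.compl_univ, measure_empty] at this
    obtain ⟨N, hN⟩ := (h1.eventually_lt_const hε).exists
    have h2 := ProbabilityMeasure.limsup_measure_closed_le_of_tendsto hT
      (hA N).isClosed_compl
    have h3 := eventually_lt_of_limsup_lt (h2.trans_lt hN)
    filter_upwards [h3, tendsto_fst.eventually_ge_atTop N] with q hq hqN
    exact (measure_mono (Set.compl_subset_compl.2 (hm hqN))).trans hq.le
  exact (ENNReal.tendsto_toReal ENNReal.zero_ne_top).comp key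

/-- The filter `⊤` on policies encodes uniformity. In the induction, E f_n(X_{t+1}, U_{t+1}) ≤ a/2 +
C P(X_{t+1} ∉ A_n), and that probability is the expectation of Tn(A_nᶜ | X_t, U_t). This is again a
bounded function converging continuously to 0, hence the quantification over `f` inside the
induction. No tightness is needed. -/
theorem tendsto_integral_eval_zero [SecondCountableTopology X] [CompactSpace U]
    {Tn : ℕ → Kernel (X × U) X}
    [∀ n, IsMarkovKernel (Tn n)] {T : Kernel (X × U) X} [IsMarkovKernel T]
    (hT : ∀ p, Tendsto (fun q : ℕ × (X × U) => law (Tn q.1) q.2) (atTop ×ˢ 𝓝 p)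
      (𝓝 (law T p))) (x₀ : X) (t : ℕ) :
    ∀ {f : ℕ → X × U → ℝ} {C : ℝ}, (∀ n, Measurable (f n)) → (∀ n p, 0 ≤ f n p) →
      (∀ n p, f n p ≤ C) →
      (∀ p, Tendsto (fun q : ℕ × (X × U) => f q.1 q.2) (atTop ×ˢ 𝓝 p) (𝓝 0)) →
      Tendsto (fun r : ℕ × Policy X U => ∫ ω, f r.1 (ω t) ∂(pathMeasure (Tn r.1) r.2 x₀))
        (atTop ×ˢ ⊤) (𝓝 0) := by
  induction t with
  | zero =>
    intro f C hm h0 hC hf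
    refine tendsto_order.2 ⟨fun a ha => Eventually.of_forall fun r =>
      ha.trans_le (integral_nonneg fun ω => h0 _ _), fun a ha => ?_⟩
    -- The bound at x₀ holds for every action at once, hence for the initial action of every policy.
    have h1 := (eventually_forall_le_of_tendsto_zero hf (half_pos ha) x₀).curry.mono
      fun n hn => hn.self_of_nhds
    filter_upwards [(tendsto_fst (g := (⊤ : Filter (Policy X U)))).eventually h1] with r hr
    rw [integral_eval_zero _ _ _ (hm _)]
    linarith [hr (r.2.init x₀)]
  | succ t ih =>
    intro f C hm h0 hC hf
    refine tendsto_order.2 ⟨fun a ha => Eventually.of_forall fun r =>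
      ha.trans_le (integral_nonneg fun ω => h0 _ _), fun a ha => ?_⟩
    obtain ⟨A, hA, hAm, hAU, hAf⟩ := exists_isOpen_exhaustion_of_tendsto_zero hf (half_pos ha)
    have h1 := ih (f := fun n p => (Tn n p).real (A n)ᶜ) (C := 1)
      (fun n => ((Tn n).measurable_coe (hA n).measurableSet.compl).ennreal_toReal)
      (fun n p => measureReal_nonneg) (fun n p => measureReal_le_one)
      (fun p => tendsto_measureReal_compl_of_exhaustion (hT p) hA hAm hAU)
    have h2 := h1.const_mul C
    rw [mul_zero] at h2
    filter_upwards [h2.eventually_lt_const (half_pos ha)] with r hr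
    have hAc : Measurable ((A r.1)ᶜ.indicator (1 : X → ℝ)) :=
      measurable_one.indicator (hA r.1).measurableSet.compl
    have hb : ∀ x, |(A r.1)ᶜ.indicator (1 : X → ℝ) x| ≤ 1 := fun x => by
      by_cases hx : x ∈ (A r.1)ᶜ <;> simp [hx]
    have h3 := integral_eval_succ_fst (Tn r.1) r.2 x₀ t hAc hb
    simp only [integral_indicator_one (hA r.1).measurableSet.compl] at h3
    have hi : Integrable (fun ω : ℕ → X × U => (A r.1)ᶜ.indicator (1 : X → ℝ) (ω (t + 1)).1)
        (pathMeasure (Tn r.1) r.2 x₀) :=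
      Integrable.of_bound (hAc.comp (measurable_fst.comp
        (measurable_pi_apply _))).aestronglyMeasurable 1 (ae_of_all _ fun ω => hb _)
    have h4 : ∫ ω, f r.1 (ω (t + 1)) ∂(pathMeasure (Tn r.1) r.2 x₀) ≤
        ∫ ω, (a / 2 + C * (A r.1)ᶜ.indicator (1 : X → ℝ) (ω (t + 1)).1)
          ∂(pathMeasure (Tn r.1) r.2 x₀) := by
      refine integral_mono_of_nonneg (ae_of_all _ fun ω => h0 _ _)
        ((integrable_const _).add (hi.const_mul C)) (ae_of_all _ fun ω => ?_)
      by_cases hx : (ω (t + 1)).1 ∈ A r.1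
      · simpa [hx] using hAf r.1 _ hx (ω (t + 1)).2
      · simpa [hx] using (hC r.1 (ω (t + 1))).trans (by linarith)
    rw [integral_add (integrable_const _) (hi.const_mul C), integral_const_mul, h3] at h4
    simp only [integral_const, probReal_univ, one_smul] at h4
    linarith

end ContinuousConvergence

/-! ### Optimality equation and near-minimizers -/

section Bellman

variable {X U : Type*} [TopologicalSpace X] [MeasurableSpace X] [MeasurableSpace U]

theorem abs_integral_kernel_le (S : Kernel (X × U) X) [IsMarkovKernel S] (v : X →ᵇ ℝ)
    (p : X × U) : |∫ y, v y ∂(S p)| ≤ ‖v‖ := by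
  simpa using norm_integral_le_of_norm_le_const (μ := S p)
    (ae_of_all _ fun y => v.norm_coe_le_norm y)

variable [OpensMeasurableSpace X]

theorem abs_integral_kernel_sub_le (S : Kernel (X × U) X) [IsMarkovKernel S] (v w : X →ᵇ ℝ)
    (p : X × U) : |∫ y, v y ∂(S p) - ∫ y, w y ∂(S p)| ≤ dist v w := by
  rw [← integral_sub (v.integrable _) (w.integrable _)]
  have h : ∀ y, ‖v y - w y‖ ≤ dist v w := fun y => by
    rw [← dist_eq_norm]; exact BoundedContinuousFunction.dist_coe_le_dist y
  simpa using norm_integral_le_of_norm_le_const (μ := S p) (ae_of_all _ h)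

variable [TopologicalSpace U] [Nonempty U]

/-- Existence of a bounded continuous solution of the discounted cost optimality equation. -/
theorem exists_bellman_solution [CompactSpace U] {β : ℝ} (hβ0 : 0 < β) (hβ1 : β < 1) {c : X × U → ℝ}
    (hc : Continuous c) {C : ℝ} (hC : ∀ p, |c p| ≤ C) (T : Kernel (X × U) X) [IsMarkovKernel T]
    (hT : ∀ v : X →ᵇ ℝ, Continuous fun p => ∫ y, v y ∂(T p)) :
    ∃ v : X →ᵇ ℝ, (∀ p, v p.1 ≤ c p + β * ∫ y, v y ∂(T p)) ∧
      ∀ x, ∃ u, c (x, u) + β * ∫ y, v y ∂(T (x, u)) = v x := by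
  let Q : (X →ᵇ ℝ) → X → U → ℝ := fun v x u => c (x, u) + β * ∫ y, v y ∂(T (x, u))
  have hQ : ∀ v, Continuous (Function.uncurry (Q v)) := fun v =>
    hc.add (continuous_const.mul (hT v))
  have hQx : ∀ v x, Continuous (Q v x) := fun v x => (hQ v).comp (Continuous.prodMk_right x)
  let I : (X →ᵇ ℝ) → X → ℝ := fun v x => sInf (Q v x '' Set.univ)
  have hI : ∀ v, Continuous (I v) := fun v => isCompact_univ.continuous_sInf (hQ v)
  have hle : ∀ v x u, I v x ≤ Q v x u := fun v x u =>
    csInf_le (isCompact_univ.image (hQx v x)).bddBelow (Set.mem_image_of_mem _ (Set.mem_univ u))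
  have hatt : ∀ v x, ∃ u, Q v x u = I v x := fun v x => by
    obtain ⟨u, -, hu⟩ := (isCompact_univ.image (hQx v x)).sInf_mem
      (Set.univ_nonempty.image _)
    exact ⟨u, hu⟩
  have hb : ∀ v x, ‖I v x‖ ≤ C + β * ‖v‖ := fun v x => by
    obtain ⟨u, hu⟩ := hatt v x
    rw [← hu, Real.norm_eq_abs]
    refine (abs_add_le _ _).trans (add_le_add (hC _) ?_)
    rw [abs_mul, abs_of_pos hβ0]
    exact mul_le_mul_of_nonneg_left (abs_integral_kernel_le T v _) hβ0.le
  let B : (X →ᵇ ℝ) → (X →ᵇ ℝ) := fun v =>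
    BoundedContinuousFunction.ofNormedAddCommGroup (I v) (hI v) (C + β * ‖v‖) (hb v)
  -- A minimizer for `w` is tried in the problem for `v`; exchanging the two gives the contraction
  -- estimate.
  have hone : ∀ v w x, I v x - I w x ≤ β * dist v w := fun v w x => by
    obtain ⟨u, hu⟩ := hatt w x
    have h1 := hle v x u
    have h2 := mul_le_mul_of_nonneg_left
      ((le_abs_self _).trans (abs_integral_kernel_sub_le T v w (x, u))) hβ0.le
    rw [← hu]
    simp only [Q] at h1 ⊢
    linarith
  have hB : ContractingWith ⟨β, hβ0.le⟩ B := by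
    refine ⟨by exact_mod_cast hβ1, LipschitzWith.of_dist_le_mul fun v w => ?_⟩
    refine (BoundedContinuousFunction.dist_le (mul_nonneg hβ0.le dist_nonneg)).2 fun x => ?_
    rw [Real.dist_eq]
    refine abs_le.2 ⟨?_, hone v w x⟩
    have := hone w v x
    rw [dist_comm w v] at this
    change -(β * dist v w) ≤ I v x - I w x
    linarith
  have hfix : ∀ x, I (ContractingWith.fixedPoint B hB) x = ContractingWith.fixedPoint B hB x :=
    fun x => DFunLike.congr_fun hB.fixedPoint_isFixedPt x
  refine ⟨ContractingWith.fixedPoint B hB, fun p => ?_, fun x => ?_⟩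
  · rw [← hfix]; exact hle _ p.1 p.2
  · rw [← hfix]; exact hatt _ x

/-- Near-minimizers of a continuous function over the actions can be chosen measurably. -/
theorem exists_measurable_near_minimizer [TopologicalSpace.SeparableSpace U] {Q : X × U → ℝ}
    (hQ : Continuous Q) {v : X → ℝ} (hv : Continuous v) (hmin : ∀ x, ∃ u, Q (x, u) = v x)
    {ε : ℝ} (hε : 0 < ε) :
    ∃ γ : X → U, Measurable γ ∧ ∀ x, Q (x, γ x) ≤ v x + ε := by
  classical
  -- The slack ε makes the set of good actions open and nonempty, so a dense sequence meets it;
  -- choosing the first such index is measurable.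
  have hex : ∀ x, ∃ i : ℕ, Q (x, TopologicalSpace.denseSeq U i) < v x + ε := fun x => by
    obtain ⟨u, hu⟩ := hmin x
    have ho : IsOpen {u | Q (x, u) < v x + ε} :=
      isOpen_lt (hQ.comp (by fun_prop)) continuous_const
    obtain ⟨-, hi, ⟨i, rfl⟩⟩ := (TopologicalSpace.denseRange_denseSeq U).inter_open_nonempty _ ho
      ⟨u, by simp [hu, hε]⟩
    exact ⟨i, hi⟩
  refine ⟨fun x => TopologicalSpace.denseSeq U (Nat.find (hex x)), ?_,
    fun x => (Nat.find_spec (hex x)).le⟩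
  refine (measurable_from_nat (f := TopologicalSpace.denseSeq U)).comp
    (measurable_find hex fun i => ?_)
  exact (isOpen_lt (hQ.comp (by fun_prop)) (hv.add continuous_const)).measurableSet

end Bellman

/-! ### Discounted cost as a sum of Bellman residuals -/

section Value

theorem summable_pow_mul_of_bounded {β : ℝ} (hβ0 : 0 < β) (hβ1 : β < 1) {a : ℕ → ℝ} {C : ℝ}
    (ha : ∀ t, |a t| ≤ C) : Summable fun t => β ^ t * a t := by
  refine Summable.of_norm_bounded ((summable_geometric_of_lt_one hβ0.le hβ1).mul_right C)
    fun t => ?_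
  rw [Real.norm_eq_abs, abs_mul, abs_of_pos (pow_pos hβ0 t)]
  exact mul_le_mul_of_nonneg_left (ha t) (pow_pos hβ0 t).le

variable {X U : Type*} [MeasurableSpace X] [MeasurableSpace U]

theorem integrable_eval (S : Kernel (X × U) X) [IsMarkovKernel S] (γ : Policy X U) (x₀ : X)
    {f : X × U → ℝ} (hf : Measurable f) {C : ℝ} (hC : ∀ p, |f p| ≤ C) (t : ℕ) :
    Integrable (fun ω => f (ω t)) (pathMeasure S γ x₀) :=
  Integrable.of_bound (hf.comp (measurable_pi_apply t)).aestronglyMeasurable C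
    (ae_of_all _ fun _ => hC _)

theorem abs_integral_eval_le (S : Kernel (X × U) X) [IsMarkovKernel S] (γ : Policy X U) (x₀ : X)
    {f : X × U → ℝ} {C : ℝ} (hC : ∀ p, |f p| ≤ C) (t : ℕ) :
    |∫ ω, f (ω t) ∂(pathMeasure S γ x₀)| ≤ C := by
  simpa using norm_integral_le_of_norm_le_const (μ := pathMeasure S γ x₀) (C := C)
    (f := fun ω => f (ω t)) (ae_of_all _ fun ω => hC (ω t))

theorem discountedCost_eq_tsum {β : ℝ} (hβ0 : 0 < β) (hβ1 : β < 1) {c : X × U → ℝ}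
    (hc : Measurable c) {C : ℝ} (hC : ∀ p, |c p| ≤ C) (S : Kernel (X × U) X) [IsMarkovKernel S]
    (γ : Policy X U) (x₀ : X) :
    discountedCost β c S γ x₀ = ∑' t : ℕ, β ^ t * ∫ ω, c (ω t) ∂(pathMeasure S γ x₀) := by
  rw [discountedCost, ← integral_tsum_of_summable_integral_norm]
  · simp only [integral_const_mul]
  · exact fun t => (integrable_eval S γ x₀ hc hC t).const_mul _
  · have : ∀ t : ℕ, ∫ ω, ‖β ^ t * c (ω t)‖ ∂(pathMeasure S γ x₀) =
        β ^ t * ∫ ω, |c (ω t)| ∂(pathMeasure S γ x₀) := fun t => by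
      rw [← integral_const_mul]
      simp only [Real.norm_eq_abs, abs_mul, abs_of_pos (pow_pos hβ0 t)]
    simp only [this]
    exact summable_pow_mul_of_bounded hβ0 hβ1
      (abs_integral_eval_le S γ x₀ (f := fun p => |c p|) (by simpa using hC))

/-- The discounted cost exceeds `v x₀` by the expected discounted sum of the Bellman residuals
of `v` along the path. -/
theorem discountedCost_sub_eq_tsum {β : ℝ} (hβ0 : 0 < β) (hβ1 : β < 1) {c : X × U → ℝ}
    (hc : Measurable c) {C : ℝ} (hC : ∀ p, |c p| ≤ C) (S : Kernel (X × U) X) [IsMarkovKernel S]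
    (γ : Policy X U) (x₀ : X) {v : X → ℝ} (hv : Measurable v) {D : ℝ} (hD : ∀ x, |v x| ≤ D) :
    discountedCost β c S γ x₀ - v x₀ = ∑' t : ℕ, β ^ t *
      ∫ ω, (c (ω t) + β * ∫ y, v y ∂(S (ω t)) - v (ω t).1) ∂(pathMeasure S γ x₀) := by
  have hP : Measurable fun p => ∫ y, v y ∂(S p) :=
    hv.stronglyMeasurable.integral_kernel.measurable
  have hPD : ∀ p, |∫ y, v y ∂(S p)| ≤ D := fun p => by
    simpa using norm_integral_le_of_norm_le_const (μ := S p) (f := v) (C := D) (ae_of_all _ hD)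
  set b : ℕ → ℝ := fun t => ∫ ω, v (ω t).1 ∂(pathMeasure S γ x₀)
  have hb : ∀ t, |b t| ≤ D := abs_integral_eval_le S γ x₀ (f := fun p => v p.1) fun p => hD _
  have hb0 : b 0 = v x₀ := integral_eval_zero S γ x₀ (f := fun p => v p.1)
    (hv.comp measurable_fst)
  -- Weighted by `β ^ t`, the terms in `b` telescope to `-b 0 = -v x₀`.
  have hstep : ∀ t, ∫ ω, (c (ω t) + β * ∫ y, v y ∂(S (ω t)) - v (ω t).1) ∂(pathMeasure S γ x₀) =
      ∫ ω, c (ω t) ∂(pathMeasure S γ x₀) + β * b (t + 1) - b t := fun t => by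
    have h1 := integrable_eval S γ x₀ hc hC t
    have h2 := (integrable_eval S γ x₀ hP hPD t).const_mul β
    have h3 := integrable_eval S γ x₀ (f := fun p => v p.1) (hv.comp measurable_fst)
      (fun p => hD _) t
    refine (integral_sub (h1.add h2) h3).trans ?_
    rw [integral_add' h1 h2, integral_const_mul, ← integral_eval_succ_fst S γ x₀ t hv hD]
  have hsb := summable_pow_mul_of_bounded hβ0 hβ1 hb
  have hsb' : Summable fun t => β ^ (t + 1) * b (t + 1) := (summable_nat_add_iff 1).2 hsb
  have hsa := summable_pow_mul_of_bounded hβ0 hβ1 (abs_integral_eval_le S γ x₀ hC)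
  have hsum := hsb.tsum_eq_zero_add
  rw [discountedCost_eq_tsum hβ0 hβ1 hc hC]
  have : ∀ t, β ^ t *
      ∫ ω, (c (ω t) + β * ∫ y, v y ∂(S (ω t)) - v (ω t).1) ∂(pathMeasure S γ x₀) =
      β ^ t * ∫ ω, c (ω t) ∂(pathMeasure S γ x₀) + β ^ (t + 1) * b (t + 1) - β ^ t * b t :=
    fun t => by rw [hstep]; ring
  simp only [this]
  rw [(hsa.add hsb').tsum_sub hsb, hsa.tsum_add hsb', hsum, pow_zero, one_mul, hb0]
  ring

end Value

/-! ### Common limit of the optimal costs -/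

section Robustness

variable {X U : Type*} [PseudoMetricSpace X] [SecondCountableTopology X] [MeasurableSpace X]
  [BorelSpace X] [PseudoMetricSpace U] [CompactSpace U] [Nonempty U] [MeasurableSpace U]
  [BorelSpace U]

/-- Under continuous weak convergence of the kernels, the optimal costs over all policies and over
stationary policies both converge to a value that depends on the limit kernel alone. -/
theorem exists_tendsto_optimalCost {β : ℝ} (hβ0 : 0 < β) (hβ1 : β < 1) {c : X × U → ℝ}
    (hc : Continuous c) {C : ℝ} (hC : ∀ p, |c p| ≤ C) (T : Kernel (X × U) X) [IsMarkovKernel T]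
    (hTc : ∀ v : X →ᵇ ℝ, Continuous fun p => ∫ y, v y ∂(T p)) (x₀ : X) :
    ∃ V : ℝ, ∀ (Tn : ℕ → Kernel (X × U) X) [∀ n, IsMarkovKernel (Tn n)],
      (∀ p, Tendsto (fun q : ℕ × (X × U) => law (Tn q.1) q.2) (atTop ×ˢ 𝓝 p) (𝓝 (law T p))) →
      Tendsto (fun n => optimalCost β c (Tn n) x₀) atTop (𝓝 V) ∧
      Tendsto (fun n => stationaryOptimalCost β c (Tn n) x₀) atTop (𝓝 V) := by
  obtain ⟨v, hvle, hvatt⟩ := exists_bellman_solution hβ0 hβ1 hc hC T hTc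
  refine ⟨v x₀, fun Tn _ hT => ?_⟩
  have hvD : ∀ x, |v x| ≤ ‖v‖ := v.norm_coe_le_norm
  have hvm : Measurable v := v.continuous.measurable
  set Q : X × U → ℝ := fun p => c p + β * ∫ y, v y ∂(T p) with hQdef
  have hQ : Continuous Q := hc.add (continuous_const.mul (hTc v))
  have hQb : ∀ p, |Q p - v p.1| ≤ C + β * ‖v‖ + ‖v‖ := fun p => by
    refine (abs_sub _ _).trans (add_le_add ((abs_add_le _ _).trans (add_le_add (hC p) ?_)) (hvD _))
    rw [abs_mul, abs_of_pos hβ0]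
    exact mul_le_mul_of_nonneg_left (abs_integral_kernel_le T v p) hβ0.le
  have hQm : Measurable fun p : X × U => Q p - v p.1 :=
    (hQ.sub (v.continuous.comp continuous_fst)).measurable
  set e : ℕ → X × U → ℝ := fun n p => ∫ y, v y ∂(Tn n p) - ∫ y, v y ∂(T p) with hedef
  have hem : ∀ n, Measurable (e n) := fun n =>
    hvm.stronglyMeasurable.integral_kernel.measurable.sub (hTc v).measurable
  have heb : ∀ n p, |e n p| ≤ ‖v‖ + ‖v‖ := fun n p => (abs_sub _ _).trans
    (add_le_add (abs_integral_kernel_le (Tn n) v p) (abs_integral_kernel_le T v p))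
  have he : ∀ p, Tendsto (fun q : ℕ × (X × U) => |e q.1 q.2|) (atTop ×ˢ 𝓝 p) (𝓝 0) := fun p => by
    have h1 := ProbabilityMeasure.tendsto_iff_forall_integral_tendsto.1 (hT p) v
    have h2 : Tendsto (fun q : ℕ × (X × U) => ∫ y, v y ∂(T q.2)) (atTop ×ˢ 𝓝 p)
        (𝓝 (∫ y, v y ∂(T p))) := ((hTc v).tendsto p).comp tendsto_snd
    have h3 := (h1.sub h2).abs
    change Tendsto _ _ (𝓝 |∫ y, v y ∂(T p) - ∫ y, v y ∂(T p)|) at h3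
    rw [sub_self, abs_zero] at h3
    exact h3
  set r : ℕ × Policy X U → ℕ → ℝ :=
    fun s t => ∫ ω, |e s.1 (ω t)| ∂(pathMeasure (Tn s.1) s.2 x₀) with hrdef
  have hr : ∀ t, Tendsto (fun s => r s t) (atTop ×ˢ ⊤) (𝓝 0) := fun t =>
    tendsto_integral_eval_zero hT x₀ t (f := fun n p => |e n p|) (fun n => (hem n).abs)
      (fun n p => abs_nonneg _) heb he
  have hrb : ∀ s t, |r s t| ≤ ‖v‖ + ‖v‖ := fun s =>
    abs_integral_eval_le _ _ _ (f := fun p => |e s.1 p|) (by simpa using heb s.1)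
  set R : ℕ × Policy X U → ℝ := fun s => ∑' t, β ^ t * (β * r s t) with hRdef
  have hβr : ∀ s t, |β * r s t| ≤ β * (‖v‖ + ‖v‖) := fun s t => by
    rw [abs_mul, abs_of_pos hβ0]
    exact mul_le_mul_of_nonneg_left (hrb s t) hβ0.le
  have hRs : ∀ s, Summable fun t => β ^ t * (β * r s t) := fun s =>
    summable_pow_mul_of_bounded hβ0 hβ1 (hβr s)
  -- Dominated convergence for series along a geometric bound; the filter keeps the uniformity over
  -- policies.
  have hR : Tendsto R (atTop ×ˢ ⊤) (𝓝 0) := by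
    have := tendsto_tsum_of_dominated_convergence (𝓕 := atTop ×ˢ (⊤ : Filter (Policy X U)))
      (f := fun s t => β ^ t * (β * r s t)) (g := fun _ => (0 : ℝ))
      (bound := fun t => β ^ t * (β * (‖v‖ + ‖v‖)))
      ((summable_geometric_of_lt_one hβ0.le hβ1).mul_right _)
      (fun t => by simpa using ((hr t).const_mul β).const_mul (β ^ t))
      (Eventually.of_forall fun s t => by
        rw [Real.norm_eq_abs, abs_mul, abs_of_pos (pow_pos hβ0 t)]
        exact mul_le_mul_of_nonneg_left (hβr s t) (pow_pos hβ0 t).le)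
    simpa using this
  set q : ℕ × Policy X U → ℕ → ℝ :=
    fun s t => ∫ ω, (Q (ω t) - v (ω t).1) ∂(pathMeasure (Tn s.1) s.2 x₀) with hqdef
  have hq0 : ∀ s t, 0 ≤ q s t := fun s t =>
    integral_nonneg fun ω => sub_nonneg.2 (hvle (ω t))
  have hqb : ∀ s t, |q s t| ≤ C + β * ‖v‖ + ‖v‖ := fun s =>
    abs_integral_eval_le _ _ _ (f := fun p => Q p - v p.1) hQb
  have hqs : ∀ s, Summable fun t => β ^ t * q s t := fun s =>
    summable_pow_mul_of_bounded hβ0 hβ1 (hqb s)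
  have hJ : ∀ s : ℕ × Policy X U,
      |discountedCost β c (Tn s.1) s.2 x₀ - v x₀ - ∑' t, β ^ t * q s t| ≤ R s := fun s => by
    have hres : ∀ t, ∫ ω, (c (ω t) + β * ∫ y, v y ∂(Tn s.1 (ω t)) - v (ω t).1)
        ∂(pathMeasure (Tn s.1) s.2 x₀) =
        q s t + β * ∫ ω, e s.1 (ω t) ∂(pathMeasure (Tn s.1) s.2 x₀) := fun t => by
      rw [hqdef, ← integral_const_mul, ← integral_add
        (integrable_eval _ _ _ (f := fun p => Q p - v p.1) hQm hQb t)
        ((integrable_eval _ _ _ (hem s.1) (heb s.1) t).const_mul β)]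
      refine integral_congr_ae (ae_of_all _ fun ω => ?_)
      simp only [hQdef, hedef]
      ring
    set i : ℕ → ℝ := fun t => ∫ ω, e s.1 (ω t) ∂(pathMeasure (Tn s.1) s.2 x₀)
    have hir : ∀ t, |β ^ t * (β * i t)| ≤ β ^ t * (β * r s t) := fun t => by
      rw [abs_mul, abs_mul, abs_of_pos (pow_pos hβ0 t), abs_of_pos hβ0]
      exact mul_le_mul_of_nonneg_left (mul_le_mul_of_nonneg_left
        abs_integral_le_integral_abs hβ0.le) (pow_pos hβ0 t).le
    have his : Summable fun t => β ^ t * (β * i t) := Summable.of_norm_bounded (hRs s) hir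
    rw [discountedCost_sub_eq_tsum hβ0 hβ1 hc.measurable hC _ _ _ hvm hvD]
    simp only [hres, mul_add]
    rw [(hqs s).tsum_add his, add_sub_cancel_left]
    exact tsum_of_norm_bounded (f := fun t => β ^ t * (β * i t)) (hRs s).hasSum hir
  have hlow : ∀ ε > 0, ∀ᶠ n in atTop, ∀ γ : Policy X U, |R (n, γ)| < ε := fun ε hε => by
    have h1 := (hR.abs.eventually_lt_const (u := ε) (by simpa using hε)).curry
    exact h1.mono fun n hn => eventually_top.1 hn
  have hge : ∀ ε > 0, ∀ᶠ n in atTop, ∀ γ : Policy X U,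
      v x₀ - ε ≤ discountedCost β c (Tn n) γ x₀ := fun ε hε => by
    filter_upwards [hlow ε hε] with n hn γ
    have h1 := (abs_le.1 (hJ (n, γ))).1
    have h2 := (abs_lt.1 (hn γ)).2
    have h3 : 0 ≤ ∑' t, β ^ t * q (n, γ) t :=
      tsum_nonneg fun t => mul_nonneg (pow_pos hβ0 t).le (hq0 _ t)
    dsimp only at h1
    linarith
  have hnear : ∀ ε > 0, ∃ γ : StationaryPolicy X U, ∀ᶠ n in atTop,
      discountedCost β c (Tn n) γ.toPolicy x₀ < v x₀ + ε := fun ε hε => by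
    -- A residual of at most this size at every time sums to at most ε/2 after discounting; the
    -- other half of ε absorbs `R`.
    have hδ : 0 < ε / 2 * (1 - β) := mul_pos (half_pos hε) (by linarith)
    obtain ⟨g, hgm, hg⟩ := exists_measurable_near_minimizer hQ v.continuous hvatt hδ
    refine ⟨⟨g, hgm⟩, ?_⟩
    filter_upwards [hlow (ε / 2) (half_pos hε)] with n hn
    set γ : StationaryPolicy X U := ⟨g, hgm⟩
    have h1 := (abs_le.1 (hJ (n, γ.toPolicy))).2
    have h2 := (abs_lt.1 (hn γ.toPolicy)).2
    have h3 : ∀ t, q (n, γ.toPolicy) t ≤ ε / 2 * (1 - β) := fun t => by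
      have hS : MeasurableSet {p : X × U | Q p - v p.1 ≤ ε / 2 * (1 - β)} :=
        measurableSet_le hQm measurable_const
      have hae := ae_eval_mem_of_stationary (Tn n) γ x₀ hS
        (fun x => sub_le_iff_le_add'.2 (hg x)) t
      have := integral_mono_ae
        (integrable_eval (Tn n) γ.toPolicy x₀ (f := fun p => Q p - v p.1) hQm hQb t)
        (integrable_const (ε / 2 * (1 - β))) hae
      simpa using this
    have h4 : ∑' t, β ^ t * q (n, γ.toPolicy) t ≤ ε / 2 := by
      have hgeo := summable_geometric_of_lt_one hβ0.le hβ1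
      calc ∑' t, β ^ t * q (n, γ.toPolicy) t ≤ ∑' t : ℕ, β ^ t * (ε / 2 * (1 - β)) :=
            (hqs _).tsum_le_tsum (fun t => mul_le_mul_of_nonneg_left (h3 t) (pow_pos hβ0 t).le)
              (hgeo.mul_right _)
        _ = ε / 2 := by
            rw [tsum_mul_right, tsum_geometric_of_lt_one hβ0.le hβ1]
            have : 1 - β ≠ 0 := by linarith
            field_simp
    dsimp only at h1
    linarith
  -- Used only to have some policy, so that the infima range over nonempty families.
  obtain ⟨γ₀, -⟩ := hnear 1 one_pos
  have : Nonempty (StationaryPolicy X U) := ⟨γ₀⟩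
  have : Nonempty (Policy X U) := ⟨γ₀.toPolicy⟩
  -- One argument serves both infima: any family of policies containing the stationary ones has the
  -- limit v(x₀).
  have hinf : ∀ {ι : Type _} [Nonempty ι] (π : ι → Policy X U),
      (∀ γ : StationaryPolicy X U, ∃ i, π i = γ.toPolicy) →
      Tendsto (fun n => ⨅ i, discountedCost β c (Tn n) (π i) x₀) atTop (𝓝 (v x₀)) := by
    intro ι _ π hπ
    refine tendsto_order.2 ⟨fun a ha => ?_, fun a ha => ?_⟩
    · filter_upwards [hge ((v x₀ - a) / 2) (by linarith)] with n hn
      have := le_ciInf fun i => hn (π i)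
      linarith
    · obtain ⟨γ, hγ⟩ := hnear (a - v x₀) (by linarith)
      obtain ⟨i, hi⟩ := hπ γ
      -- `hge 1` supplies the lower bound without which a real infimum need not lie below its terms.
      filter_upwards [hγ, hge 1 one_pos] with n hn hbd
      have := ciInf_le (f := fun i => discountedCost β c (Tn n) (π i) x₀)
        ⟨v x₀ - 1, by rintro _ ⟨j, rfl⟩; exact hbd _⟩ i
      rw [hi] at this
      linarith
  exact ⟨hinf id fun γ => ⟨_, rfl⟩, hinf StationaryPolicy.toPolicy fun γ => ⟨γ, rfl⟩⟩

end Robustness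

end MDP

/-! ### Identification of the limit -/

theorem mainTheorem7 {m k : ℕ}
    (X : Set (EuclideanSpace ℝ (Fin m))) (hX : MeasurableSet X)
    (U : Set (EuclideanSpace ℝ (Fin k))) (hU : IsCompact U)
    (β : ℝ) (hβ0 : 0 < β) (hβ1 : β < 1)
    (c : X × U → ℝ) (hc : Continuous c) (hcb : ∃ C : ℝ, ∀ p, |c p| ≤ C)
    (Tn : ℕ → Kernel (X × U) X) [∀ n, IsMarkovKernel (Tn n)]
    (T : Kernel (X × U) X) [IsMarkovKernel T]
    (hT : ∀ (xs : ℕ → X) (us : ℕ → U) (x : X) (u : U),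
      Tendsto (fun n => (xs n, us n)) atTop (𝓝 (x, u)) →
      Tendsto (fun n => MDP.law (Tn n) (xs n, us n)) atTop (𝓝 (MDP.law T (x, u))))
    (x₀ : X) :
    Tendsto (fun n => MDP.optimalCost β c (Tn n) x₀) atTop (𝓝 (MDP.optimalCost β c T x₀)) ∧
    Tendsto (fun n => MDP.stationaryOptimalCost β c (Tn n) x₀) atTop
      (𝓝 (MDP.stationaryOptimalCost β c T x₀)) ∧
    ∀ (γn : ℕ → MDP.StationaryPolicy X U) (γ : MDP.StationaryPolicy X U),
      (∀ n, MDP.IsOptimalStationary β c (Tn n) x₀ (γn n)) →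
      MDP.IsOptimalStationary β c T x₀ γ →
      Tendsto (fun n => MDP.discountedCost β c (Tn n) (γn n).toPolicy x₀) atTop
        (𝓝 (MDP.discountedCost β c T γ.toPolicy x₀)) := by
  have hattain : ∀ (S : Kernel (X × U) X) [IsMarkovKernel S] (g : MDP.StationaryPolicy X U),
      MDP.IsOptimalStationary β c S x₀ g →
      MDP.stationaryOptimalCost β c S x₀ = MDP.discountedCost β c S g.toPolicy x₀ :=
    fun S _ g hg => by
      have : Nonempty (MDP.StationaryPolicy X U) := ⟨g⟩
      exact le_antisymm (ciInf_le ⟨_, by rintro _ ⟨g', rfl⟩; exact hg g'⟩ g) (le_ciInf hg)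
  have hTf : ∀ p, Tendsto (fun q : ℕ × (X × U) => MDP.law (Tn q.1) q.2) (atTop ×ˢ 𝓝 p)
      (𝓝 (MDP.law T p)) := fun p =>
    MDP.tendsto_atTop_prod_nhds_of_seq (F := fun n => MDP.law (Tn n)) fun s hs =>
      hT (fun n => (s n).1) (fun n => (s n).2) p.1 p.2 hs
  -- Weak continuity of `T` is not assumed separately: it follows from continuous convergence.
  have hTc : ∀ v : BoundedContinuousFunction X ℝ, Continuous fun p => ∫ y, v y ∂(T p) :=
    fun v => MDP.continuous_of_tendsto_atTop_prod_nhds (F := fun n p => ∫ y, v y ∂(Tn n p))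
      fun p => ProbabilityMeasure.tendsto_iff_forall_integral_tendsto.1 (hTf p) v
  have hconst : ∀ p, Tendsto (fun q : ℕ × (X × U) => MDP.law T q.2) (atTop ×ˢ 𝓝 p)
      (𝓝 (MDP.law T p)) := fun p =>
    ProbabilityMeasure.tendsto_iff_forall_integral_tendsto.2 fun v =>
      ((hTc v).tendsto p).comp tendsto_snd
  have hlim : Tendsto (fun n => MDP.optimalCost β c (Tn n) x₀) atTop
        (𝓝 (MDP.optimalCost β c T x₀)) ∧
      Tendsto (fun n => MDP.stationaryOptimalCost β c (Tn n) x₀) atTop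
        (𝓝 (MDP.stationaryOptimalCost β c T x₀)) := by
    obtain ⟨C, hC⟩ := hcb
    have : CompactSpace U := isCompact_iff_compactSpace.1 hU
    rcases isEmpty_or_nonempty U with hUe | hUne
    -- Without actions there are no policies, and every infimum takes the default value 0.
    · have : IsEmpty (MDP.Policy X U) := ⟨fun γ => hUe.false (γ.init x₀)⟩
      have : IsEmpty (MDP.StationaryPolicy X U) := ⟨fun γ => hUe.false (γ.1 x₀)⟩
      simp [MDP.optimalCost, MDP.stationaryOptimalCost, Real.iInf_of_isEmpty]
    · obtain ⟨V, hV⟩ := MDP.exists_tendsto_optimalCost hβ0 hβ1 hc hC T hTc x₀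
      -- The constant sequence also converges to `V`, so `V` equals both optimal costs of `T`.
      have h1 := hV (fun _ => T) hconst
      rw [tendsto_nhds_unique tendsto_const_nhds h1.1,
        tendsto_nhds_unique tendsto_const_nhds h1.2]
      exact hV Tn hTf
  refine ⟨hlim.1, hlim.2, fun γn γ hγn hγ => ?_⟩
  rw [← hattain T γ hγ]
  exact hlim.2.congr fun n => hattain (Tn n) (γn n) (hγn n)
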